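/- Let $\mathsf X$ be a Polish space (for instance a separable Banach space) with its Borel $\sigma$-algebra and let $\mu_{\mathrm{pr}}$ be a probability measure on $\mathsf X$. For levels $1,\dots,\mathsf L$ let $\pi_0,\dots,\pi_{\mathsf L}$ (posterior densities) and $Q_1,\dots,Q_{\mathsf L}$ (proposal densities) be probability densities with respect to $\mu_{\mathrm{pr}}$. Assume: (1) all $Q_\ell$ and (2) all $\pi_j$ are continuous and strictly positive; (3) for $1\le\ell\le\mathsf L$, $j\in\{\ell-1,\ell\}$ and $r>0$ the set $\{Q_\ell/\pi_j\le r\}$ is compact; (4) there is $c\in(0,1)$, independent of $\ell$, with $\operatorname{ess\,inf}_{\mu_{\mathrm{pr}}} Q_\ell/\pi_j\ge c$ for $j\in\{\ell-1,\ell\}$; (5) there are $r>1$, $C_r>0$, independent of $\ell$, with $\int Q_\ell^r\,d\mu_{\mathrm{pr}}\le C_r$. For $1\le\ell\le\mathsf L$ and $j\in\{\ell-1,\ell\}$ put $\alpha_j(\theta,z)=\min\{1,\tfrac{Q_\ell(\theta)\pi_j(z)}{Q_\ell(z)\pi_j(\theta)}\}$. For $\boldsymbol\theta=(\theta_{\ell-1},\theta_\ell)\in\mathsf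 X^2$ abbreviate $a(z)=\alpha_{\ell-1}(\theta_{\ell-1},z)$, $b(z)=\alpha_\ell(\theta_\ell,z)$, $q(dz)=Q_\ell(z)\mu_{\mathrm{pr}}(dz)$, and let $$\boldsymbol p_\ell(\boldsymbol\theta,A)=\int \min\{a,b\}\mathbf 1_{(z,z)\in A}\,dq+\int (a-b)^+\mathbf 1_{(z,\theta_\ell)\in A}\,dq+\int (b-a)^+\mathbf 1_{(\theta_{\ell-1},z)\in A}\,dq+\mathbf 1_{\boldsymbol\theta\in A}\Big(1-\int\max\{a,b\}\,dq\Big)$$ be the (in general non-reversible) transition kernel of the coupled chain, with Markov operator $\boldsymbol P_\ell$. Let $\nu_\ell$ be the invariant probability measure of $\boldsymbol p_\ell$. For an operator $T$ on $L^2(\nu_\ell)$ preserving the mean-zero subspace $L^2_0(\nu_\ell)$ let $\gamma_2[T]=1-\|T\|_{L^2_0\to L^2_0}$, and let $$\gamma_{\mathrm{ps}}=\gamma_{\mathrm{ps}}[\boldsymbol P_\ell]=\max_{k\ge1}\gamma_2\big[(\boldsymbol P_\ell^*)^k\boldsymbol P_\ell^k\big]/k$$ be the pseudo-spectral gap, where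 $\boldsymbol P_\ell^*$ is the adjoint in $L^2(\nu_\ell)$. **Theorem (non-asymptotic bound on the mean square error).** Let $1\le\ell\le\mathsf L$, let $Y_\ell\in L^2(\mathsf X^2,\nu_\ell)$ be real-valued, let $\nu^0$ be a probability measure on $\mathsf X^2$ with $\nu^0\ll\nu_\ell$ and $\frac{d\nu^0}{d\nu_\ell}\in L^\infty(\nu_\ell)$, and let $(\boldsymbol\theta^n)_{n\ge0}$ be the Markov chain with kernel $\boldsymbol p_\ell$ and $\boldsymbol\theta^0\sim\nu^0$. Then $\gamma_{\mathrm{ps}}>0$, and for all integers $N_\ell\ge1$ and $n_b\ge0$ the squared error of the burn-in ergodic average is integrable and $$\mathsf E\left|\frac1{N_\ell}\sum_{n=1}^{N_\ell}Y_\ell(\boldsymbol\theta^{n+n_b})-\int Y_\ell\,d\nu_\ell\right|^2\le C_{\mathrm{mse},\ell}\,\frac{\mathbb V_{\nu_\ell}[Y_\ell]}{N_\ell},$$ where $C_{\mathrm{mse},\ell}=C_{\mathrm{inv},\ell}+C_{\mathrm{ns},\ell}$, $C_{\mathrm{inv},\ell}=1+\frac4{\gamma_{\mathrm{ps}}}$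 and $C_{\mathrm{ns},\ell}=2\left\|\frac{d\nu^0}{d\nu_\ell}-1\right\|_{L^\infty(\nu_\ell)}\left(1+\frac4{\gamma_{\mathrm{ps}}}\right)$. -/

import Mathlib

open MeasureTheory ProbabilityTheory Set
open scoped ENNReal NNReal

noncomputable section

/-! ### Markov operators on `L²(ν)` -/

section MarkovOperator

variable {S : Type*} [MeasurableSpace S]

theorem memLp_two_integral_kernel (p : Kernel S S) [IsMarkovKernel p] {ν : Measure S}
    (hν : p.Invariant ν) {f : S → ℝ} (hf : MemLp f 2 ν) :
    MemLp (fun x => ∫ y, f y ∂(p x)) 2 ν ∧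
      eLpNorm (fun x => ∫ y, f y ∂(p x)) 2 ν ≤ eLpNorm f 2 ν := by
  have hb : p ∘ₘ ν = ν := hν
  have hm : AEStronglyMeasurable f (p ∘ₘ ν) := by rw [hb]; exact hf.1
  have hsm : AEStronglyMeasurable (fun x => ∫ y, f y ∂(p x)) ν := by
    refine ⟨fun x => ∫ y, hm.mk f y ∂(p x), hm.stronglyMeasurable_mk.integral_kernel, ?_⟩
    filter_upwards [Measure.ae_ae_of_ae_comp hm.ae_eq_mk] with x hx
    exact integral_congr_ae hx
  have hle : eLpNorm (fun x => ∫ y, f y ∂(p x)) 2 ν ≤ eLpNorm f 2 ν := by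
    rw [eLpNorm_eq_lintegral_rpow_enorm_toReal (by norm_num) (by norm_num),
      eLpNorm_eq_lintegral_rpow_enorm_toReal (by norm_num) (by norm_num)]
    refine ENNReal.rpow_le_rpow ?_ (by norm_num)
    have h1 : ∫⁻ x, ‖f x‖ₑ ^ (2 : ℝ≥0∞).toReal ∂ν
        = ∫⁻ x, ∫⁻ y, ‖f y‖ₑ ^ (2 : ℝ≥0∞).toReal ∂(p x) ∂ν := by
      conv_lhs => rw [← hb]
      exact Measure.lintegral_bind p.measurable.aemeasurable (hm.enorm.pow_const _)
    rw [h1]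
    refine lintegral_mono_ae ?_
    filter_upwards [Measure.ae_ae_of_ae_comp hm.ae_eq_mk] with x hx
    have hfx : AEStronglyMeasurable f (p x) := ⟨_, hm.stronglyMeasurable_mk, hx⟩
    have h2 : ‖∫ y, f y ∂(p x)‖ₑ ≤ eLpNorm f 2 (p x) :=
      (enorm_integral_le_lintegral_enorm f).trans
        ((eLpNorm_one_eq_lintegral_enorm (f := f) (μ := p x)).symm.le.trans
          (eLpNorm_le_eLpNorm_of_exponent_le (by norm_num) hfx))
    calc ‖∫ y, f y ∂(p x)‖ₑ ^ (2 : ℝ≥0∞).toReal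
        ≤ (eLpNorm f 2 (p x)) ^ (2 : ℝ≥0∞).toReal := ENNReal.rpow_le_rpow h2 (by norm_num)
      _ = ∫⁻ y, ‖f y‖ₑ ^ (2 : ℝ≥0∞).toReal ∂(p x) := by
          rw [eLpNorm_eq_lintegral_rpow_enorm_toReal (by norm_num) (by norm_num),
            ← ENNReal.rpow_mul]
          norm_num
  exact ⟨⟨hsm, hle.trans_lt hf.2⟩, hle⟩

theorem ae_integrable_kernel (p : Kernel S S) [IsMarkovKernel p] {ν : Measure S}
    [IsProbabilityMeasure ν] (hν : p.Invariant ν) (f : Lp ℝ 2 ν) :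
    ∀ᵐ x ∂ν, Integrable f (p x) := by
  have hb : p ∘ₘ ν = ν := hν
  have h : Integrable f (p ∘ₘ ν) := by
    rw [hb]; exact (Lp.memLp f).integrable (by norm_num)
  exact Measure.ae_integrable_of_integrable_comp h

theorem ae_ae_kernel (p : Kernel S S) {ν : Measure S} (hν : p.Invariant ν)
    {q : S → Prop} (h : ∀ᵐ y ∂ν, q y) : ∀ᵐ x ∂ν, ∀ᵐ y ∂(p x), q y := by
  have hb : p ∘ₘ ν = ν := hν
  rw [← hb] at h
  exact Measure.ae_ae_of_ae_comp h

/-- The Markov operator `(P f)(x) = ∫ f(y) p(x, dy)` on `L²(ν)`, for a `ν`-invariant Markov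
kernel `p`. -/
def markovOperator (p : Kernel S S) [IsMarkovKernel p] (ν : Measure S) [IsProbabilityMeasure ν]
    (hν : p.Invariant ν) : Lp ℝ 2 ν →L[ℝ] Lp ℝ 2 ν :=
  LinearMap.mkContinuous
    { toFun := fun f => (memLp_two_integral_kernel p hν (Lp.memLp f)).1.toLp
        (fun x => ∫ y, f y ∂(p x))
      map_add' := by
        intro f g
        rw [← MemLp.toLp_add]
        refine MemLp.toLp_congr _ _ ?_
        filter_upwards [ae_integrable_kernel p hν f, ae_integrable_kernel p hν g,
          ae_ae_kernel p hν (Lp.coeFn_add f g)] with x hf hg hx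
        rw [integral_congr_ae hx]
        exact integral_add hf hg
      map_smul' := by
        intro c f
        rw [RingHom.id_apply, ← MemLp.toLp_const_smul]
        refine MemLp.toLp_congr _ _ ?_
        filter_upwards [ae_ae_kernel p hν (Lp.coeFn_smul c f)] with x hx
        rw [integral_congr_ae hx]
        exact integral_const_mul c _ }
    1 (by
      intro f
      rw [one_mul, LinearMap.coe_mk, AddHom.coe_mk, Lp.norm_toLp, Lp.norm_def]
      exact ENNReal.toReal_mono (Lp.memLp f).eLpNorm_ne_top
        (memLp_two_integral_kernel p hν (Lp.memLp f)).2)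

theorem coeFn_markovOperator (p : Kernel S S) [IsMarkovKernel p] (ν : Measure S)
    [IsProbabilityMeasure ν] (hν : p.Invariant ν) (f : Lp ℝ 2 ν) :
    markovOperator p ν hν f =ᵐ[ν] fun x => ∫ y, f y ∂(p x) :=
  MemLp.coeFn_toLp (memLp_two_integral_kernel p hν (Lp.memLp f)).1

/-- The subspace `L²₀(ν)` of functions in `L²(ν)` with `ν`-mean zero. -/
def meanZero (ν : Measure S) [IsProbabilityMeasure ν] : Submodule ℝ (Lp ℝ 2 ν) where
  carrier := {f | ∫ x, f x ∂ν = 0}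
  add_mem' := by
    intro f g hf hg
    simp only [mem_ofPred_eq] at hf hg ⊢
    rw [integral_congr_ae (Lp.coeFn_add f g)]
    have := integral_add ((Lp.memLp f).integrable (by norm_num))
      ((Lp.memLp g).integrable (by norm_num))
    simp only [Pi.add_apply]
    rw [this, hf, hg, add_zero]
  zero_mem' := by
    simp only [mem_ofPred_eq]
    rw [integral_congr_ae (Lp.coeFn_zero ℝ 2 ν)]
    simp
  smul_mem' := by
    intro c f hf
    simp only [mem_ofPred_eq] at hf ⊢
    rw [integral_congr_ae (Lp.coeFn_smul c f)]
    simp only [Pi.smul_apply, smul_eq_mul]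
    rw [integral_const_mul, hf, mul_zero]

/-- The `L²`-spectral gap `γ₂[T] = 1 - ‖T‖_{L²₀ → L²₀}`. It is used for operators `T` that map
`L²₀(ν)` into itself; the norm of `T` as an operator `L²₀ → L²₀` is the norm of its restriction
to `L²₀`. -/
def spectralGap {ν : Measure S} [IsProbabilityMeasure ν] (T : Lp ℝ 2 ν →L[ℝ] Lp ℝ 2 ν) : ℝ :=
  1 - ‖T.comp (meanZero ν).subtypeL‖

/-- The pseudo-spectral gap `γ_ps[P] = max_{k ≥ 1} γ₂[(P*)ᵏ Pᵏ] / k`, where `P*` is the adjoint of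
`P` in `L²(ν)`. (The set of values is bounded above by `1`; as `0 ≤ γ₂[(P*)ᵏ Pᵏ] ≤ 1` for Markov
operators, the supremum is a maximum.) -/
def pseudoSpectralGap (p : Kernel S S) [IsMarkovKernel p] (ν : Measure S) [IsProbabilityMeasure ν]
    (hν : p.Invariant ν) : ℝ :=
  ⨆ k : ℕ+, spectralGap
    (ContinuousLinearMap.adjoint (markovOperator p ν hν) ^ (k : ℕ)
      * markovOperator p ν hν ^ (k : ℕ)) / (k : ℝ)

/-! ### The chain and its ergodic estimator -/

/-- The law on trajectories `(θ⁰, θ¹, …)` of the Markov chain with `θ⁰ ∼ ν⁰` and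
`θⁿ⁺¹ ∼ p(θⁿ, ·)`. -/
def chainLaw (p : Kernel S S) [IsMarkovKernel p] (ν₀ : Measure S) : Measure (ℕ → S) :=
  Kernel.trajMeasure (X := fun _ => S) ν₀
    (fun n => p.comap (fun x : (i : Finset.Iic n) → S => x ⟨n, Finset.mem_Iic.2 le_rfl⟩)
      (measurable_pi_apply _))

/-- The ergodic estimator `(1/N) ∑_{n=1}^N Y(θ^{n + n_b})` with burn-in `n_b`. -/
def ergodicEstimator (Y : S → ℝ) (N nb : ℕ) (θ : ℕ → S) : ℝ :=
  1 / (N : ℝ) * ∑ n ∈ Finset.Icc 1 N, Y (θ (n + nb))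

/-- The squared error of the ergodic estimator along a trajectory. -/
def squaredError (ν : Measure S) (Y : S → ℝ) (N nb : ℕ) (θ : ℕ → S) : ℝ :=
  (ergodicEstimator Y N nb θ - ∫ x, Y x ∂ν) ^ 2

/-- The mean square error of the ergodic estimator for the chain started from `ν₀`. -/
def meanSquareError (p : Kernel S S) [IsMarkovKernel p] (ν₀ ν : Measure S) (Y : S → ℝ)
    (N nb : ℕ) : ℝ :=
  ∫ θ, squaredError ν Y N nb θ ∂(chainLaw p ν₀)

/-- `dν⁰/dν`, as a real-valued function. -/
def initialDensity (ν₀ ν : Measure S) (x : S) : ℝ := (ν₀.rnDeriv ν x).toReal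

/-- `‖dν⁰/dν - 1‖_{L^∞(ν)}`. -/
def initialDiscrepancy (ν₀ ν : Measure S) : ℝ :=
  (eLpNorm (fun x => initialDensity ν₀ ν x - 1) ∞ ν).toReal

/-- `C_inv = 1 + 4 / γ_ps`. -/
def constInv (p : Kernel S S) [IsMarkovKernel p] (ν : Measure S) [IsProbabilityMeasure ν]
    (hν : p.Invariant ν) : ℝ :=
  1 + 4 / pseudoSpectralGap p ν hν

/-- `C_ns = 2 ‖dν⁰/dν - 1‖_{L^∞(ν)} (1 + 4 / γ_ps)`. -/
def constNs (p : Kernel S S) [IsMarkovKernel p] (ν₀ ν : Measure S) [IsProbabilityMeasure ν]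
    (hν : p.Invariant ν) : ℝ :=
  2 * initialDiscrepancy ν₀ ν * (1 + 4 / pseudoSpectralGap p ν hν)

/-- `C_mse = C_inv + C_ns`. -/
def constMse (p : Kernel S S) [IsMarkovKernel p] (ν₀ ν : Measure S) [IsProbabilityMeasure ν]
    (hν : p.Invariant ν) : ℝ :=
  constInv p ν hν + constNs p ν₀ ν hν

end MarkovOperator

/-! ### The multi-level independent Metropolis-Hastings chain -/

/-- The data of the multi-level method: a prior probability measure, posterior densities
`π_0, …, π_L` and proposal densities `Q_1, …, Q_L`, all with respect to the prior. The level
`ℓ ∈ {1, …, L}` is represented by `i : Fin L` with `ℓ = i + 1`, so that `post i.succ` is `π_ℓ`,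
`post i.castSucc` is `π_{ℓ-1}` and `prop i` is `Q_ℓ`. -/
structure MultilevelModel (X : Type*) [MeasurableSpace X] where
  L : ℕ
  prior : Measure X
  post : Fin (L + 1) → X → ℝ
  prop : Fin L → X → ℝ
  prior_prob : IsProbabilityMeasure prior
  post_measurable : ∀ j, Measurable (post j)
  post_nonneg : ∀ j z, 0 ≤ post j z
  post_lintegral : ∀ j, ∫⁻ z, ENNReal.ofReal (post j z) ∂prior = 1
  prop_measurable : ∀ i, Measurable (prop i)
  prop_nonneg : ∀ i z, 0 ≤ prop i z
  prop_lintegral : ∀ i, ∫⁻ z, ENNReal.ofReal (prop i z) ∂prior = 1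

attribute [instance] MultilevelModel.prior_prob

/-- The acceptance probability `α(θ, z) = min{1, Q(θ) π(z) / (Q(z) π(θ))}` of the independent
Metropolis-Hastings algorithm with target density `π` and proposal density `Q`. -/
def acceptProb {X : Type*} (π Q : X → ℝ) (θ z : X) : ℝ :=
  min 1 (Q θ * π z / (Q z * π θ))

theorem acceptProb_nonneg {X : Type*} {π Q : X → ℝ} (hπ : ∀ z, 0 ≤ π z) (hQ : ∀ z, 0 ≤ Q z)
    (θ z : X) : 0 ≤ acceptProb π Q θ z :=
  le_min zero_le_one (div_nonneg (mul_nonneg (hQ _) (hπ _)) (mul_nonneg (hQ _) (hπ _)))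

theorem acceptProb_le_one {X : Type*} (π Q : X → ℝ) (θ z : X) : acceptProb π Q θ z ≤ 1 :=
  min_le_left _ _

theorem measurable_map_withDensity {X S T : Type*} [MeasurableSpace X] [MeasurableSpace S]
    [MeasurableSpace T] (μ : Measure X) [SFinite μ] {f : S → X → ℝ≥0∞} {g : S → X → T}
    (hf : Measurable (Function.uncurry f)) (hg : Measurable (Function.uncurry g)) :
    Measurable fun s => (μ.withDensity (f s)).map (g s) := by
  refine Measure.measurable_of_measurable_coe _ fun A hA => ?_
  have hgs : ∀ s, Measurable (g s) := fun s => hg.comp measurable_prodMk_left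
  have : (fun s => (μ.withDensity (f s)).map (g s) A)
      = fun s => ∫⁻ z, (Function.uncurry g ⁻¹' A).indicator (Function.uncurry f) (s, z) ∂μ := by
    funext s
    rw [Measure.map_apply (hgs s) hA, withDensity_apply _ (hgs s hA),
      ← lintegral_indicator (hgs s hA)]
    rfl
  rw [this]
  exact (hf.indicator (hg hA)).lintegral_prod_right'

namespace MultilevelModel

variable {X : Type*} [MeasurableSpace X] (M : MultilevelModel X)

/-- `α_{ℓ-1}(θ_{ℓ,ℓ-1}, z)`, for the pair `θ = (θ_{ℓ,ℓ-1}, θ_{ℓ,ℓ})`. -/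
def acceptCoarse (i : Fin M.L) (θ : X × X) (z : X) : ℝ :=
  acceptProb (M.post i.castSucc) (M.prop i) θ.1 z

/-- `α_ℓ(θ_{ℓ,ℓ}, z)`, for the pair `θ = (θ_{ℓ,ℓ-1}, θ_{ℓ,ℓ})`. -/
def acceptFine (i : Fin M.L) (θ : X × X) (z : X) : ℝ :=
  acceptProb (M.post i.succ) (M.prop i) θ.2 z

theorem measurable_acceptCoarse (i : Fin M.L) :
    Measurable (Function.uncurry (M.acceptCoarse i)) := by
  have h1 := M.post_measurable i.castSucc
  have h2 := M.prop_measurable i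
  unfold Function.uncurry acceptCoarse acceptProb
  fun_prop

theorem measurable_acceptFine (i : Fin M.L) :
    Measurable (Function.uncurry (M.acceptFine i)) := by
  have h1 := M.post_measurable i.succ
  have h2 := M.prop_measurable i
  unfold Function.uncurry acceptFine acceptProb
  fun_prop

/-- The probability that at least one component moves,
`∫ max{α_{ℓ-1}(θ_{ℓ,ℓ-1}, z), α_ℓ(θ_{ℓ,ℓ}, z)} Q_ℓ(z) μ_pr(dz)`. -/
def moveProb (i : Fin M.L) (θ : X × X) : ℝ≥0∞ :=
  ∫⁻ z, ENNReal.ofReal (max (M.acceptCoarse i θ z) (M.acceptFine i θ z) * M.prop i z) ∂M.prior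

/-- The joint transition kernel of the two coupled independent Metropolis-Hastings chains at level
`ℓ`, which use the same proposal `z ∼ Q_ℓ μ_pr` and the same uniform variable in the
accept-reject step: both components move to `z`, or only the coarse one does, or only
the fine one does, or neither. -/
def jointKernel (i : Fin M.L) : Kernel (X × X) (X × X) where
  toFun θ :=
    (M.prior.withDensity fun z => ENNReal.ofReal
        (min (M.acceptCoarse i θ z) (M.acceptFine i θ z) * M.prop i z)).map (fun z => (z, z))
    + (M.prior.withDensity fun z => ENNReal.ofReal
        (max (M.acceptCoarse i θ z - M.acceptFine i θ z) 0 * M.prop i z)).map (fun z => (z, θ.2))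
    + (M.prior.withDensity fun z => ENNReal.ofReal
        (max (M.acceptFine i θ z - M.acceptCoarse i θ z) 0 * M.prop i z)).map (fun z => (θ.1, z))
    + (1 - M.moveProb i θ) • Measure.dirac θ
  measurable' := by
    have h0 := M.prop_measurable i
    have h1 : Measurable fun q : (X × X) × X => M.acceptCoarse i q.1 q.2 :=
      M.measurable_acceptCoarse i
    have h2 : Measurable fun q : (X × X) × X => M.acceptFine i q.1 q.2 :=
      M.measurable_acceptFine i
    have h3 : Measurable fun q : (X × X) × X => M.prop i q.2 := h0.comp measurable_snd
    have hm : Measurable (M.moveProb i) := by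
      unfold moveProb
      exact Measurable.lintegral_prod_right'
        (f := fun q : (X × X) × X => ENNReal.ofReal
          (max (M.acceptCoarse i q.1 q.2) (M.acceptFine i q.1 q.2) * M.prop i q.2))
        ((h1.max h2).mul h3).ennreal_ofReal
    have hadd : ∀ {m n : X × X → Measure (X × X)}, Measurable m → Measurable n →
        Measurable fun θ => m θ + n θ := fun hm' hn' =>
      Measure.measurable_of_measurable_coe _ fun A hA => by
        simp only [Measure.add_apply]
        exact ((Measure.measurable_coe hA).comp hm').add ((Measure.measurable_coe hA).comp hn')
    refine hadd (hadd (hadd ?_ ?_) ?_) ?_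
    · exact measurable_map_withDensity M.prior
        (f := fun θ z => ENNReal.ofReal
          (min (M.acceptCoarse i θ z) (M.acceptFine i θ z) * M.prop i z))
        (g := fun (_ : X × X) z => (z, z))
        ((h1.min h2).mul h3).ennreal_ofReal (measurable_snd.prodMk measurable_snd)
    · exact measurable_map_withDensity M.prior
        (f := fun θ z => ENNReal.ofReal
          (max (M.acceptCoarse i θ z - M.acceptFine i θ z) 0 * M.prop i z))
        (g := fun (θ : X × X) z => (z, θ.2))
        (((h1.sub h2).max measurable_const).mul h3).ennreal_ofReal
        (measurable_snd.prodMk (measurable_snd.comp measurable_fst))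
    · exact measurable_map_withDensity M.prior
        (f := fun θ z => ENNReal.ofReal
          (max (M.acceptFine i θ z - M.acceptCoarse i θ z) 0 * M.prop i z))
        (g := fun (θ : X × X) z => (θ.1, z))
        (((h2.sub h1).max measurable_const).mul h3).ennreal_ofReal
        ((measurable_fst.comp measurable_fst).prodMk measurable_snd)
    · refine Measure.measurable_of_measurable_coe _ fun A hA => ?_
      simp only [Measure.smul_apply, smul_eq_mul]
      exact (measurable_const.sub hm).mul (Measure.measurable_coe hA |>.comp Measure.measurable_dirac)

instance (i : Fin M.L) : IsMarkovKernel (M.jointKernel i) where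
  isProbabilityMeasure θ := by
    constructor
    have h1 : Measurable fun z => M.acceptCoarse i θ z :=
      (M.measurable_acceptCoarse i).comp measurable_prodMk_left
    have h2 : Measurable fun z => M.acceptFine i θ z :=
      (M.measurable_acceptFine i).comp measurable_prodMk_left
    have h3 := M.prop_measurable i
    have hQ := M.prop_nonneg i
    have a0 : ∀ z, 0 ≤ M.acceptCoarse i θ z := fun z =>
      acceptProb_nonneg (M.post_nonneg _) hQ _ _
    have b0 : ∀ z, 0 ≤ M.acceptFine i θ z := fun z =>
      acceptProb_nonneg (M.post_nonneg _) hQ _ _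
    have a1 : ∀ z, M.acceptCoarse i θ z ≤ 1 := fun z => acceptProb_le_one _ _ _ _
    have b1 : ∀ z, M.acceptFine i θ z ≤ 1 := fun z => acceptProb_le_one _ _ _ _
    have hle : M.moveProb i θ ≤ 1 := by
      rw [← M.prop_lintegral i]
      refine lintegral_mono fun z => ENNReal.ofReal_le_ofReal ?_
      exact mul_le_of_le_one_left (hQ z) (max_le (a1 z) (b1 z))
    simp only [jointKernel, Kernel.coe_mk, Measure.add_apply, Measure.smul_apply]
    rw [Measure.map_apply (by fun_prop) .univ, Measure.map_apply (by fun_prop) .univ,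
      Measure.map_apply (by fun_prop) .univ]
    simp only [preimage_univ, withDensity_apply _ MeasurableSet.univ, Measure.restrict_univ,
      measure_univ, smul_eq_mul, mul_one]
    rw [← lintegral_add_left (by fun_prop), ← lintegral_add_left (by fun_prop)]
    have : ∀ z, ENNReal.ofReal (min (M.acceptCoarse i θ z) (M.acceptFine i θ z) * M.prop i z)
        + ENNReal.ofReal (max (M.acceptCoarse i θ z - M.acceptFine i θ z) 0 * M.prop i z)
        + ENNReal.ofReal (max (M.acceptFine i θ z - M.acceptCoarse i θ z) 0 * M.prop i z)
        = ENNReal.ofReal (max (M.acceptCoarse i θ z) (M.acceptFine i θ z) * M.prop i z) := by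
      intro z
      rw [← ENNReal.ofReal_add (mul_nonneg (le_min (a0 z) (b0 z)) (hQ z))
          (mul_nonneg (le_max_right _ _) (hQ z)),
        ← ENNReal.ofReal_add (add_nonneg (mul_nonneg (le_min (a0 z) (b0 z)) (hQ z))
          (mul_nonneg (le_max_right _ _) (hQ z))) (mul_nonneg (le_max_right _ _) (hQ z)),
        ← add_mul, ← add_mul]
      congr 2
      rcases le_total (M.acceptCoarse i θ z) (M.acceptFine i θ z) with h | h
      · rw [min_eq_left h, max_eq_right h, max_eq_right (sub_nonpos.2 h),
          max_eq_left (sub_nonneg.2 h)]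
        ring
      · rw [min_eq_right h, max_eq_left h, max_eq_right (sub_nonpos.2 h),
          max_eq_left (sub_nonneg.2 h)]
        ring
    simp only [this]
    exact add_tsub_cancel_of_le hle

/-- The standing assumptions on the proposal and posterior densities. -/
structure Assumptions [TopologicalSpace X] : Prop where
  prop_continuous : ∀ i, Continuous (M.prop i)
  prop_pos : ∀ i z, 0 < M.prop i z
  post_continuous : ∀ j, Continuous (M.post j)
  post_pos : ∀ j z, 0 < M.post j z
  compact_coarse : ∀ i, ∀ r : ℝ, 0 < r →
    IsCompact {θ | M.prop i θ / M.post i.castSucc θ ≤ r}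
  compact_fine : ∀ i, ∀ r : ℝ, 0 < r →
    IsCompact {θ | M.prop i θ / M.post i.succ θ ≤ r}
  ess_inf : ∃ c : ℝ, 0 < c ∧ c < 1 ∧ ∀ i,
    (∀ᵐ z ∂M.prior, c ≤ M.prop i z / M.post i.castSucc z) ∧
    (∀ᵐ z ∂M.prior, c ≤ M.prop i z / M.post i.succ z)
  moments : ∃ r C : ℝ, 1 < r ∧ 0 < C ∧ ∀ i,
    ∫⁻ z, ENNReal.ofReal (M.prop i z ^ r) ∂M.prior ≤ ENNReal.ofReal C

end MultilevelModel

end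

/-! ### Invariant kernels and their Markov operators -/

section MarkovOperatorLemmas

variable {S : Type*} [MeasurableSpace S]

/-! The argument has three independent ingredients. Positive gap: the ratios `Q_ℓ/π_j` are
continuous with compact sublevel sets, hence bounded below by a positive constant at every point.
The part of the kernel that moves both components to the same `z` then dominates one nonzero measure
`m` on the diagonal, whatever the current state (`exists_minorizing_measure`). Such a Doeblin
condition makes `P` a contraction on `L²₀`, and the term `k = 1` already gives `γ_ps ≥ m(univ) > 0`
(`measureReal_le_pseudoSpectralGap_of_minorized`). Stationary error: for the centred function `f`,
the mean square of the sum is a double sum of the correlations `⟨f, P^|i-j| f⟩`. For each `k` these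
decay geometrically in blocks of length `k`, with ratio `√(1 - γ₂[(P*)ᵏPᵏ])`. Summation and the
supremum over `k` give the bound `(4 / γ_ps) · V / N` (`pseudoSpectralGap_mul_integral_sq_sum_le`).
Reversibility plays no role. Initial law: with `D = ‖dν⁰/dν - 1‖_∞` one has `ν⁰ ≤ (1 + D) ν`. The
trajectory laws inherit this domination (`chainLaw_le_smul`), so integrability and error bound
transfer at the cost of a factor `1 + D`. -/

theorem integral_integral_of_invariant (p : Kernel S S) [IsMarkovKernel p] {ν : Measure S}
    [IsProbabilityMeasure ν] (hν : p.Invariant ν) {f : S → ℝ} (hf : Integrable f ν) :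
    Integrable (fun x => ∫ y, f y ∂(p x)) ν ∧ ∫ x, ∫ y, f y ∂(p x) ∂ν = ∫ x, f x ∂ν := by
  have hsnd : MeasurePreserving Prod.snd (ν ⊗ₘ p) ν :=
    ⟨measurable_snd, by
      have h := Measure.snd_compProd ν p
      rw [Measure.snd] at h
      rw [h]; exact hν⟩
  have hi : Integrable (fun q : S × S => f q.2) (ν ⊗ₘ p) := hsnd.integrable_comp_of_integrable hf
  refine ⟨?_, ?_⟩
  · have h := MeasureTheory.Integrable.integral_compProd hi
    simpa using h
  have h1 := Measure.integral_compProd hi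
  rw [← h1]
  have h2 := integral_map (μ := ν ⊗ₘ p) (φ := Prod.snd) (f := f) hsnd.aemeasurable
    (by rw [hsnd.map_eq]; exact hf.1)
  rw [hsnd.map_eq] at h2
  exact h2.symm

theorem integral_markovOperator (p : Kernel S S) [IsMarkovKernel p] (ν : Measure S)
    [IsProbabilityMeasure ν] (hν : p.Invariant ν) (f : Lp ℝ 2 ν) :
    ∫ x, markovOperator p ν hν f x ∂ν = ∫ x, f x ∂ν := by
  rw [integral_congr_ae (coeFn_markovOperator p ν hν f)]
  exact (integral_integral_of_invariant p hν ((Lp.memLp f).integrable (by norm_num))).2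

theorem mem_meanZero_iff {ν : Measure S} [IsProbabilityMeasure ν] (f : Lp ℝ 2 ν) :
    f ∈ meanZero ν ↔ ∫ x, f x ∂ν = 0 := Iff.rfl

theorem markovOperator_mem_meanZero (p : Kernel S S) [IsMarkovKernel p] (ν : Measure S)
    [IsProbabilityMeasure ν] (hν : p.Invariant ν) {f : Lp ℝ 2 ν} (hf : f ∈ meanZero ν) :
    markovOperator p ν hν f ∈ meanZero ν := by
  rw [mem_meanZero_iff] at *
  rw [integral_markovOperator, hf]

theorem markovOperator_pow_mem_meanZero (p : Kernel S S) [IsMarkovKernel p] (ν : Measure S)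
    [IsProbabilityMeasure ν] (hν : p.Invariant ν) {f : Lp ℝ 2 ν} (hf : f ∈ meanZero ν) (n : ℕ) :
    (markovOperator p ν hν ^ n) f ∈ meanZero ν := by
  induction n with
  | zero => simpa using hf
  | succ n ih =>
    rw [pow_succ', mul_apply_eq_comp]
    exact markovOperator_mem_meanZero p ν hν ih

theorem norm_markovOperator_le (p : Kernel S S) [IsMarkovKernel p] (ν : Measure S)
    [IsProbabilityMeasure ν] (hν : p.Invariant ν) (f : Lp ℝ 2 ν) :
    ‖markovOperator p ν hν f‖ ≤ ‖f‖ := by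
  have h := (markovOperator p ν hν).le_of_opNorm_le
    (LinearMap.mkContinuous_norm_le _ zero_le_one _) f
  simpa using h

theorem norm_markovOperator_pow_le (p : Kernel S S) [IsMarkovKernel p] (ν : Measure S)
    [IsProbabilityMeasure ν] (hν : p.Invariant ν) (f : Lp ℝ 2 ν) (n : ℕ) :
    ‖(markovOperator p ν hν ^ n) f‖ ≤ ‖f‖ := by
  induction n with
  | zero => simp
  | succ n ih =>
    rw [pow_succ', mul_apply_eq_comp]
    exact (norm_markovOperator_le p ν hν _).trans ih

theorem inner_const_one {ν : Measure S} [IsProbabilityMeasure ν] (f : Lp ℝ 2 ν) :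
    inner ℝ (Lp.const 2 ν (1 : ℝ)) f = ∫ x, f x ∂ν := by
  rw [L2.inner_def]
  refine integral_congr_ae ?_
  filter_upwards [Lp.coeFn_const 2 ν (1 : ℝ)] with x hx
  rw [hx]
  simp

theorem markovOperator_const_one (p : Kernel S S) [IsMarkovKernel p] (ν : Measure S)
    [IsProbabilityMeasure ν] (hν : p.Invariant ν) :
    markovOperator p ν hν (Lp.const 2 ν (1 : ℝ)) = Lp.const 2 ν (1 : ℝ) := by
  refine Lp.ext ?_
  filter_upwards [coeFn_markovOperator p ν hν (Lp.const 2 ν (1 : ℝ)),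
    ae_ae_kernel p hν (Lp.coeFn_const 2 ν (1 : ℝ)), Lp.coeFn_const 2 ν (1 : ℝ)] with x h1 h2 h3
  rw [h1, integral_congr_ae h2, h3]
  simp

/-- The mean is the inner product with the constant `1`, and `⟨1, P*f⟩ = ⟨P1, f⟩` with `P1 = 1`. -/
theorem adjoint_markovOperator_mem_meanZero (p : Kernel S S) [IsMarkovKernel p] (ν : Measure S)
    [IsProbabilityMeasure ν] (hν : p.Invariant ν) {f : Lp ℝ 2 ν} (hf : f ∈ meanZero ν) :
    ContinuousLinearMap.adjoint (markovOperator p ν hν) f ∈ meanZero ν := by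
  rw [mem_meanZero_iff] at *
  rw [← inner_const_one, ContinuousLinearMap.adjoint_inner_right, markovOperator_const_one,
    inner_const_one, hf]

theorem norm_sq_eq_integral_sq {ν : Measure S} (f : Lp ℝ 2 ν) :
    ‖f‖ ^ 2 = ∫ x, f x ^ 2 ∂ν := by
  rw [← real_inner_self_eq_norm_sq, L2.inner_def]
  simp [sq]

/-! ### Minorized kernels contract `L²₀` -/

theorem integral_sub_const_sq {m : Measure S} [IsFiniteMeasure m] {f : S → ℝ}
    (hf : Integrable f m) (hf2 : Integrable (fun x => f x ^ 2) m) (t : ℝ) :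
    Integrable (fun x => (f x - t) ^ 2) m ∧
      ∫ x, (f x - t) ^ 2 ∂m = ∫ x, f x ^ 2 ∂m - 2 * t * ∫ x, f x ∂m + m.real univ * (t * t) := by
  have e : (fun x => (f x - t) ^ 2) = fun x => f x ^ 2 - (2 * t * f x - t * t) := by
    funext x; ring
  have h : Integrable (fun x => 2 * t * f x) m := hf.const_mul _
  have h' : Integrable (fun x => 2 * t * f x - t * t) m := h.sub (integrable_const _)
  rw [e]
  refine ⟨hf2.sub h', ?_⟩
  rw [integral_sub hf2 h', integral_sub h (integrable_const _), integral_const_mul, integral_const,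
    smul_eq_mul]
  ring

/-- Cauchy-Schwarz against `1`: the quadratic `t ↦ ∫ (f - t)² dm` is nonnegative, so its
discriminant is not positive. -/
theorem sq_integral_le {m : Measure S} [IsFiniteMeasure m] {f : S → ℝ} (hf : Integrable f m)
    (hf2 : Integrable (fun x => f x ^ 2) m) :
    (∫ x, f x ∂m) ^ 2 ≤ m.real univ * ∫ x, f x ^ 2 ∂m := by
  have key : ∀ t : ℝ, 0 ≤ m.real univ * (t * t) + (-2 * ∫ x, f x ∂m) * t + ∫ x, f x ^ 2 ∂m := by
    intro t
    have h : 0 ≤ ∫ x, (f x - t) ^ 2 ∂m := integral_nonneg fun x => sq_nonneg _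
    rw [(integral_sub_const_sq hf hf2 t).2] at h
    linarith
  have := discrim_le_zero key
  rw [discrim] at this
  nlinarith

/-- The remainder `q - m` is a positive measure of mass `1 - m(univ)`. Cauchy-Schwarz for it yields
this factor, and `∫ f²` only grows when `q - m` is replaced by `q`. -/
theorem sq_integral_sub_le_of_le {m q : Measure S} [IsProbabilityMeasure q] (hmq : m ≤ q)
    {f : S → ℝ} (hf : Integrable f q) (hf2 : Integrable (fun x => f x ^ 2) q) :
    (∫ x, f x ∂q - ∫ x, f x ∂m) ^ 2 ≤ (1 - m.real univ) * ∫ x, f x ^ 2 ∂q := by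
  have : IsFiniteMeasure m := isFiniteMeasure_of_le q hmq
  have hadd : q - m + m = q := Measure.sub_add_cancel_of_le hmq
  have hle : q - m ≤ q := Measure.sub_le
  have h1 : ∫ x, f x ∂q = ∫ x, f x ∂(q - m) + ∫ x, f x ∂m := by
    conv_lhs => rw [← hadd]
    exact integral_add_measure (hf.mono_measure hle) (hf.mono_measure hmq)
  have hu : (q - m).real univ = 1 - m.real univ := by
    have := congrArg (fun μ : Measure S => μ.real univ) hadd
    have h2 : (q - m + m).real univ = (q - m).real univ + m.real univ :=
      measureReal_add_apply (μ₁ := q - m) (μ₂ := m)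
    simp only [probReal_univ] at this
    linarith
  rw [h1, add_sub_cancel_right]
  refine (sq_integral_le (hf.mono_measure hle) (hf2.mono_measure hle)).trans ?_
  rw [hu]
  refine mul_le_mul_of_nonneg_left ?_ (hu ▸ measureReal_nonneg)
  exact integral_mono_measure hle (ae_of_all _ fun x => sq_nonneg _) hf2

/-- The common part `m` contributes the same constant `c = ∫ f dm` to `Pf(x)` for all `x`. What is
left of `Pf(x)` is an integral against `p x - m`, whose mass is `1 - m(univ)`. -/
theorem norm_sq_markovOperator_le_of_minorized (p : Kernel S S) [IsMarkovKernel p] (ν : Measure S)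
    [IsProbabilityMeasure ν] (hν : p.Invariant ν) {m : Measure S} (hm : ∀ x, m ≤ p x)
    {f : Lp ℝ 2 ν} (hf : f ∈ meanZero ν) :
    ‖markovOperator p ν hν f‖ ^ 2 ≤ (1 - m.real univ) * ‖f‖ ^ 2 := by
  set g := markovOperator p ν hν f with hg
  have hf2 : Integrable (fun x => f x ^ 2) ν := (Lp.memLp f).integrable_sq
  obtain ⟨hi, he⟩ := integral_integral_of_invariant p hν hf2
  have hg0 : ∫ x, g x ∂ν = 0 := markovOperator_mem_meanZero p ν hν hf
  have hg1 : Integrable g ν := (Lp.memLp g).integrable (by norm_num)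
  have hg2 : Integrable (fun x => g x ^ 2) ν := (Lp.memLp g).integrable_sq
  have hb : p ∘ₘ ν = ν := hν
  have hsq : ∀ᵐ x ∂ν, Integrable (fun y => f y ^ 2) (p x) :=
    Measure.ae_integrable_of_integrable_comp (by rw [hb]; exact hf2)
  set c := ∫ x, f x ∂m
  have hpt : ∀ᵐ x ∂ν, (g x - c) ^ 2 ≤ (1 - m.real univ) * ∫ y, f y ^ 2 ∂(p x) := by
    filter_upwards [coeFn_markovOperator p ν hν f, ae_integrable_kernel p hν f, hsq] with x h1 h2 h3
    rw [hg, h1]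
    exact sq_integral_sub_le_of_le (hm x) h2 h3
  -- As `g` has mean zero, the integral of `(g - c)²` is `‖g‖² + c²`; the term `c²` is dropped at
  -- the end.
  obtain ⟨hint, heq⟩ := integral_sub_const_sq hg1 hg2 c
  have h := integral_mono_ae hint (hi.const_mul _) hpt
  rw [integral_const_mul, he, heq, hg0, probReal_univ] at h
  rw [norm_sq_eq_integral_sq, norm_sq_eq_integral_sq]
  nlinarith [mul_self_nonneg c]

/-! ### Lower bound for the pseudo-spectral gap -/

theorem spectralGap_div_le_one {ν : Measure S} [IsProbabilityMeasure ν]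
    (T : Lp ℝ 2 ν →L[ℝ] Lp ℝ 2 ν) (k : ℕ+) : spectralGap T / (k : ℝ) ≤ 1 := by
  have hk : (1 : ℝ) ≤ (k : ℝ) := by exact_mod_cast (one_le : 1 ≤ k)
  rw [div_le_one (by linarith), spectralGap]
  linarith [norm_nonneg (T.comp (meanZero ν).subtypeL)]

theorem spectralGap_div_le_pseudoSpectralGap (p : Kernel S S) [IsMarkovKernel p] (ν : Measure S)
    [IsProbabilityMeasure ν] (hν : p.Invariant ν) (k : ℕ+) :
    spectralGap (ContinuousLinearMap.adjoint (markovOperator p ν hν) ^ (k : ℕ)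
      * markovOperator p ν hν ^ (k : ℕ)) / (k : ℝ) ≤ pseudoSpectralGap p ν hν :=
  le_ciSup (f := fun k : ℕ+ => spectralGap
    (ContinuousLinearMap.adjoint (markovOperator p ν hν) ^ (k : ℕ)
      * markovOperator p ν hν ^ (k : ℕ)) / (k : ℝ))
    ⟨1, by rintro _ ⟨j, rfl⟩; exact spectralGap_div_le_one _ j⟩ k

theorem measureReal_le_pseudoSpectralGap_of_minorized (p : Kernel S S) [IsMarkovKernel p]
    (ν : Measure S) [IsProbabilityMeasure ν] (hν : p.Invariant ν) {m : Measure S}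
    (hm : ∀ x, m ≤ p x) : m.real univ ≤ pseudoSpectralGap p ν hν := by
  set P := markovOperator p ν hν with hP
  obtain ⟨x0⟩ : Nonempty S := nonempty_of_isProbabilityMeasure ν
  have hm1 : m.real univ ≤ 1 := by
    have : IsFiniteMeasure m := isFiniteMeasure_of_le (p x0) (hm x0)
    have h := ENNReal.toReal_mono (measure_ne_top _ _) (hm x0 univ)
    simpa [Measure.real] using h
  refine le_trans ?_ (spectralGap_div_le_pseudoSpectralGap p ν hν 1)
  simp only [PNat.one_coe, pow_one, Nat.cast_one, div_one, spectralGap]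
  rw [le_sub_comm]
  refine ContinuousLinearMap.opNorm_le_bound _ (by linarith) fun f => ?_
  set u := ContinuousLinearMap.adjoint P (P f) with hu
  have huf : ((ContinuousLinearMap.adjoint P * P).comp (meanZero ν).subtypeL) f = u := rfl
  rw [huf]
  have hu0 : u ∈ meanZero ν := adjoint_markovOperator_mem_meanZero p ν hν
    (markovOperator_mem_meanZero p ν hν f.2)
  have h1 := norm_sq_markovOperator_le_of_minorized p ν hν hm hu0
  have h2 := norm_sq_markovOperator_le_of_minorized p ν hν hm f.2
  rw [← hP] at h1 h2
  -- For `u = P*Pf` this avoids any estimate on `P*` itself: the contraction of `P` is applied to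
  -- both `f` and `u`, and one factor `‖u‖` is cancelled.
  have h3 : ‖u‖ ^ 2 ≤ ‖P f‖ * ‖P u‖ := by
    rw [← real_inner_self_eq_norm_sq]
    conv_lhs => rw [hu, ContinuousLinearMap.adjoint_inner_left]
    exact real_inner_le_norm _ _
  set e := 1 - m.real univ
  have he : 0 ≤ e := by simp only [e]; linarith
  have h4 : (‖P f‖ * ‖P u‖) ^ 2 ≤ (e * ‖f‖ * ‖u‖) ^ 2 := by
    calc (‖P f‖ * ‖P u‖) ^ 2 = ‖P f‖ ^ 2 * ‖P u‖ ^ 2 := by ring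
      _ ≤ (e * ‖f‖ ^ 2) * (e * ‖u‖ ^ 2) := by
        apply mul_le_mul h2 h1 (sq_nonneg _) (by positivity)
      _ = _ := by ring
  have h5 := (pow_le_pow_iff_left₀ (by positivity) (by positivity) two_ne_zero).1 h4
  rcases (norm_nonneg u).eq_or_lt with h0 | h0
  · rw [← h0]; positivity
  · refine le_of_mul_le_mul_right ?_ h0
    nlinarith

/-! ### Decay of correlations -/

/-- The left side equals `⟨f, (P*)ᵏPᵏ f⟩`, and `1 - γ₂` is the norm of `(P*)ᵏPᵏ` on `L²₀`. -/
theorem norm_sq_markovOperator_pow_le (p : Kernel S S) [IsMarkovKernel p] (ν : Measure S)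
    [IsProbabilityMeasure ν] (hν : p.Invariant ν) (k : ℕ) {f : Lp ℝ 2 ν} (hf : f ∈ meanZero ν) :
    ‖(markovOperator p ν hν ^ k) f‖ ^ 2 ≤
      (1 - spectralGap (ContinuousLinearMap.adjoint (markovOperator p ν hν) ^ k
        * markovOperator p ν hν ^ k)) * ‖f‖ ^ 2 := by
  set P := markovOperator p ν hν with hP
  set T := ContinuousLinearMap.adjoint P ^ k * P ^ k
  have hT : ‖T f‖ ≤ (1 - spectralGap T) * ‖f‖ := by
    have h := (T.comp (meanZero ν).subtypeL).le_opNorm ⟨f, hf⟩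
    rw [spectralGap, sub_sub_cancel]
    exact h
  have hadj : ContinuousLinearMap.adjoint P ^ k = ContinuousLinearMap.adjoint (P ^ k) := by
    simp only [← ContinuousLinearMap.star_eq_adjoint, star_pow]
  have h1 : inner ℝ f (T f) = ‖(P ^ k) f‖ ^ 2 := by
    simp only [T]
    rw [mul_apply_eq_comp, hadj, ContinuousLinearMap.adjoint_inner_right,
      real_inner_self_eq_norm_sq]
  rw [← h1]
  calc inner ℝ f (T f) ≤ ‖f‖ * ‖T f‖ := real_inner_le_norm _ _
    _ ≤ ‖f‖ * ((1 - spectralGap T) * ‖f‖) := mul_le_mul_of_nonneg_left hT (norm_nonneg _)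
    _ = _ := by ring

theorem norm_markovOperator_pow_le_sqrt_pow (p : Kernel S S) [IsMarkovKernel p] (ν : Measure S)
    [IsProbabilityMeasure ν] (hν : p.Invariant ν) (k : ℕ) {f : Lp ℝ 2 ν}
    (hf : f ∈ meanZero ν) (m : ℕ) :
    ‖(markovOperator p ν hν ^ m) f‖ ≤
      √(1 - spectralGap (ContinuousLinearMap.adjoint (markovOperator p ν hν) ^ k
        * markovOperator p ν hν ^ k)) ^ (m / k) * ‖f‖ := by
  set P := markovOperator p ν hν with hP
  set s := 1 - spectralGap (ContinuousLinearMap.adjoint P ^ k * P ^ k)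
  have hs : 0 ≤ s := by simp only [s, spectralGap, sub_sub_cancel]; positivity
  have step : ∀ g ∈ meanZero ν, ‖(P ^ k) g‖ ≤ √s * ‖g‖ := fun g hg => by
    refine (pow_le_pow_iff_left₀ (norm_nonneg _) (by positivity) two_ne_zero).1 ?_
    rw [mul_pow, Real.sq_sqrt hs]
    exact norm_sq_markovOperator_pow_le p ν hν k hg
  have main : ∀ q : ℕ, ‖(P ^ (k * q)) f‖ ≤ √s ^ q * ‖f‖ := fun q => by
    induction q with
    | zero => simp
    | succ q ih =>
      rw [mul_add, mul_one, add_comm, pow_add, mul_apply_eq_comp, pow_succ']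
      refine (step _ (markovOperator_pow_mem_meanZero p ν hν hf _)).trans ?_
      rw [mul_assoc]
      exact mul_le_mul_of_nonneg_left ih (Real.sqrt_nonneg _)
  -- Each of the `m / k` full blocks of `k` steps contributes a factor `√s`; the `m % k` leftover
  -- steps are merely nonexpansive.
  conv_lhs => rw [← Nat.mod_add_div m k, pow_add, mul_apply_eq_comp]
  exact (norm_markovOperator_pow_le p ν hν _ _).trans (main _)

/-! ### Summing the block-geometric decay -/

theorem sum_range_mul_div {k : ℕ} (hk : 0 < k) (c : ℕ → ℝ) (n : ℕ) :
    ∑ m ∈ Finset.range (k * n), c (m / k) = k * ∑ q ∈ Finset.range n, c q := by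
  induction n with
  | zero => simp
  | succ n ih =>
    rw [mul_add, mul_one, Finset.sum_range_add, ih, Finset.sum_range_succ, mul_add]
    congr 1
    rw [Finset.sum_congr rfl (g := fun _ => c n)]
    · simp
    · intro x hx
      rw [Nat.mul_add_div hk, Nat.div_eq_of_lt (Finset.mem_range.1 hx), add_zero]

/-- Each power of `r = √s` occurs at most `k` times, which cancels the `1 / k`. Since `1 - s = (1 -
r)(1 + r)`, the geometric sum leaves `(1 + r)(1 - r ^ N)`. The product form also covers `s = 1`. -/
theorem mul_sum_sqrt_pow_div_le_two {k : ℕ} (hk : 0 < k) {s : ℝ} (hs0 : 0 ≤ s) (hs1 : s ≤ 1)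
    (N : ℕ) : (1 - s) / k * ∑ m ∈ Finset.range N, √s ^ (m / k) ≤ 2 := by
  set r := √s with hr
  have hr0 : 0 ≤ r := Real.sqrt_nonneg _
  have hr1 : r ≤ 1 := Real.sqrt_le_one.2 hs1
  have hs : s = r ^ 2 := (Real.sq_sqrt hs0).symm
  have hk' : (0 : ℝ) < k := by exact_mod_cast hk
  have h1 : ∑ m ∈ Finset.range N, r ^ (m / k) ≤ k * ∑ q ∈ Finset.range N, r ^ q := by
    rw [← sum_range_mul_div hk]
    exact Finset.sum_le_sum_of_subset_of_nonneg
      (Finset.range_subset_range.2 (Nat.le_mul_of_pos_left _ hk)) fun _ _ _ => by positivity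
  have h2 := geom_sum_mul r N
  have h3 : 0 ≤ r ^ N := by positivity
  calc (1 - s) / k * ∑ m ∈ Finset.range N, r ^ (m / k)
      ≤ (1 - s) / k * (k * ∑ q ∈ Finset.range N, r ^ q) :=
        mul_le_mul_of_nonneg_left h1 (div_nonneg (by linarith) hk'.le)
    _ = (1 + r) * (1 - r ^ N) := by
        rw [hs]; field_simp; linear_combination (-1 - r) * h2
    _ ≤ 2 := by nlinarith

end MarkovOperatorLemmas

/-! ### The stationary chain -/

section Chain

variable {S : Type*} [MeasurableSpace S]

instance (p : Kernel S S) [IsMarkovKernel p] (ν : Measure S) [IsProbabilityMeasure ν] :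
    IsProbabilityMeasure (chainLaw p ν) := by
  unfold chainLaw
  infer_instance

theorem map_frestrictLe_chainLaw_compProd (p : Kernel S S) [IsMarkovKernel p] (ν : Measure S)
    [IsProbabilityMeasure ν] (n : ℕ) :
    (chainLaw p ν).map (Preorder.frestrictLe n) ⊗ₘ
        (p.comap (fun x : (i : Finset.Iic n) → S => x ⟨n, Finset.mem_Iic.2 le_rfl⟩)
          (measurable_pi_apply _))
      = (chainLaw p ν).map (fun θ => (Preorder.frestrictLe n θ, θ (n + 1))) :=
  Kernel.map_frestrictLe_trajMeasure_compProd_eq_map_trajMeasure (X := fun _ => S)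

theorem measurePreserving_eval_zero_chainLaw (p : Kernel S S) [IsMarkovKernel p] (ν : Measure S)
    [IsProbabilityMeasure ν] : MeasurePreserving (fun θ : ℕ → S => θ 0) (chainLaw p ν) ν := by
  refine ⟨measurable_pi_apply 0, ?_⟩
  have h0 : (fun θ : ℕ → S => θ 0) =
      (fun x : (i : Finset.Iic 0) → S => x ⟨0, Finset.mem_Iic.2 le_rfl⟩) ∘
        (Preorder.frestrictLe (π := fun _ => S) 0) := rfl
  rw [h0, ← Measure.map_map (measurable_pi_apply _) (by fun_prop), chainLaw, Kernel.trajMeasure,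
    Measure.map_comp _ _ (by fun_prop), Kernel.traj_map_frestrictLe, Kernel.partialTraj_self,
    Measure.id_comp, Measure.map_map (measurable_pi_apply _) (by fun_prop)]
  exact Measure.map_id

theorem measurePreserving_eval_chainLaw (p : Kernel S S) [IsMarkovKernel p] {ν : Measure S}
    [IsProbabilityMeasure ν] (hν : p.Invariant ν) (n : ℕ) :
    MeasurePreserving (fun θ : ℕ → S => θ n) (chainLaw p ν) ν := by
  induction n with
  | zero => exact measurePreserving_eval_zero_chainLaw p ν
  | succ n ih =>
    refine ⟨measurable_pi_apply _, ?_⟩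
    have h0 : (fun θ : ℕ → S => θ (n + 1)) =
      Prod.snd ∘ (fun θ : ℕ → S => (Preorder.frestrictLe (π := fun _ => S) n θ, θ (n + 1))) := rfl
    rw [h0, ← Measure.map_map measurable_snd (by fun_prop), ← map_frestrictLe_chainLaw_compProd]
    have h1 := Measure.snd_compProd ((chainLaw p ν).map (Preorder.frestrictLe n))
      (p.comap (fun x : (i : Finset.Iic n) → S => x ⟨n, Finset.mem_Iic.2 le_rfl⟩)
        (measurable_pi_apply _))
    rw [Measure.snd] at h1
    rw [h1]
    have hb : p ∘ₘ ν = ν := hν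
    refine Eq.trans ?_ hb
    ext A hA
    rw [Measure.bind_apply hA (Kernel.aemeasurable _), Measure.bind_apply hA (Kernel.aemeasurable _),
      lintegral_map (Kernel.measurable_coe _ hA) (by fun_prop),
      ← ih.lintegral_comp (Kernel.measurable_coe _ hA)]
    rfl

/-! ### Correlations along the stationary chain -/

theorem integral_chainLaw_mul_succ (p : Kernel S S) [IsMarkovKernel p] {ν : Measure S}
    [IsProbabilityMeasure ν] (hν : p.Invariant ν) {i n : ℕ} (hin : i ≤ n) {g h : S → ℝ}
    (hg : MemLp g 2 ν) (hh : MemLp h 2 ν) :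
    ∫ θ, g (θ i) * h (θ (n + 1)) ∂(chainLaw p ν)
      = ∫ θ, g (θ i) * ∫ y, h y ∂(p (θ n)) ∂(chainLaw p ν) := by
  set T := chainLaw p ν with hT
  set κ := p.comap (fun x : (i : Finset.Iic n) → S => x ⟨n, Finset.mem_Iic.2 le_rfl⟩)
    (measurable_pi_apply _) with hκ
  set pair : (ℕ → S) → ((i : Finset.Iic n) → S) × S :=
    fun θ => (Preorder.frestrictLe (π := fun _ => S) n θ, θ (n + 1))
  have hpair : Measurable pair := by fun_prop
  have hJ : T.map (Preorder.frestrictLe n) ⊗ₘ κ = T.map pair :=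
    map_frestrictLe_chainLaw_compProd p ν n
  have mp1 : MeasurePreserving
      (fun q : ((i : Finset.Iic n) → S) × S => q.1 ⟨i, Finset.mem_Iic.2 hin⟩) (T.map pair) ν :=
    ⟨by fun_prop, by
      rw [Measure.map_map (by fun_prop) hpair]
      exact (measurePreserving_eval_chainLaw p hν i).map_eq⟩
  have mp2 : MeasurePreserving
      (fun q : ((i : Finset.Iic n) → S) × S => q.2) (T.map pair) ν :=
    ⟨by fun_prop, by
      rw [Measure.map_map (by fun_prop) hpair]
      exact (measurePreserving_eval_chainLaw p hν (n + 1)).map_eq⟩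
  -- Stationarity puts both factors in `L²`, so the product is integrable and Fubini for the
  -- composition product applies.
  have hint : Integrable (fun q : ((i : Finset.Iic n) → S) × S =>
      g (q.1 ⟨i, Finset.mem_Iic.2 hin⟩) * h q.2) (T.map pair) :=
    (hg.comp_measurePreserving mp1).integrable_mul (hh.comp_measurePreserving mp2)
  have h1 := integral_map hpair.aemeasurable hint.1
  have hint' := hint
  rw [← hJ] at hint'
  have h2 := Measure.integral_compProd hint'
  have h3 := hint'.integral_compProd
  rw [hJ, h1] at h2
  refine h2.trans ?_
  simp only [Kernel.const_apply] at h3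
  rw [integral_map (by fun_prop) (by simpa using h3.1)]
  refine integral_congr_ae (ae_of_all _ fun θ => ?_)
  simp only [integral_const_mul]
  rfl

theorem integral_chainLaw_mul (p : Kernel S S) [IsMarkovKernel p] {ν : Measure S}
    [IsProbabilityMeasure ν] (hν : p.Invariant ν) (i m : ℕ) (g h : Lp ℝ 2 ν) :
    ∫ θ, g (θ i) * h (θ (i + m)) ∂(chainLaw p ν)
      = inner ℝ g ((markovOperator p ν hν ^ m) h) := by
  induction m generalizing h with
  | zero =>
    have mp := measurePreserving_eval_chainLaw p hν i
    rw [pow_zero, one_apply_eq_self, L2.inner_def]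
    have hint : Integrable (fun x => g x * h x) ν := (Lp.memLp g).integrable_mul (Lp.memLp h)
    have h1 := integral_map mp.aemeasurable (f := fun x => g x * h x)
      (by rw [mp.map_eq]; exact hint.1)
    rw [mp.map_eq] at h1
    simpa [mul_comm] using h1.symm
  | succ m ih =>
    -- The last transition is integrated out, which replaces `h` by `Ph`; hence the induction over
    -- all `h`.
    rw [pow_succ, mul_apply_eq_comp, ← ih, ← add_assoc,
      integral_chainLaw_mul_succ p hν (Nat.le_add_right i m) (Lp.memLp g) (Lp.memLp h)]
    refine integral_congr_ae ?_
    filter_upwards [(measurePreserving_eval_chainLaw p hν (i + m)).quasiMeasurePreserving.ae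
      (coeFn_markovOperator p ν hν h)] with θ hθ
    rw [hθ]

/-- Each distance from `i` is attained at most once by some `j ≤ i` and at most once by some `j >
i`. -/
theorem sum_Icc_comp_dist_le {c : ℕ → ℝ} (hc : ∀ m, 0 ≤ c m) {N i : ℕ} (hi : i ∈ Finset.Icc 1 N) :
    ∑ j ∈ Finset.Icc 1 N, c (Nat.dist i j) ≤ 2 * ∑ m ∈ Finset.range N, c m := by
  rw [Finset.mem_Icc] at hi
  have h : ∀ s : Finset ℕ, s ⊆ Finset.Icc 1 N → Set.InjOn (Nat.dist i) s →
      ∑ j ∈ s, c (Nat.dist i j) ≤ ∑ m ∈ Finset.range N, c m := fun s hs hinj => by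
    rw [← Finset.sum_image hinj]
    refine Finset.sum_le_sum_of_subset_of_nonneg ?_ fun _ _ _ => hc _
    intro m hm
    obtain ⟨j, hj, rfl⟩ := Finset.mem_image.1 hm
    have := Finset.mem_Icc.1 (hs hj)
    rw [Finset.mem_range, Nat.dist]
    omega
  rw [two_mul, ← Finset.sum_filter_add_sum_filter_not (Finset.Icc 1 N) (fun j => j ≤ i)]
  refine add_le_add (h _ (Finset.filter_subset _ _) ?_) (h _ (Finset.filter_subset _ _) ?_)
  all_goals
    intro a ha b hb hab
    simp only [Finset.coe_filter, mem_ofPred_eq, Nat.dist] at ha hb hab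
    omega

theorem inner_markovOperator_pow_le (p : Kernel S S) [IsMarkovKernel p] (ν : Measure S)
    [IsProbabilityMeasure ν] (hν : p.Invariant ν) (k : ℕ) {f : Lp ℝ 2 ν}
    (hf : f ∈ meanZero ν) (m : ℕ) :
    inner ℝ f ((markovOperator p ν hν ^ m) f) ≤
      √(1 - spectralGap (ContinuousLinearMap.adjoint (markovOperator p ν hν) ^ k
        * markovOperator p ν hν ^ k)) ^ (m / k) * ‖f‖ ^ 2 := by
  refine (real_inner_le_norm _ _).trans ?_
  calc ‖f‖ * ‖(markovOperator p ν hν ^ m) f‖ ≤ ‖f‖ * _ :=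
        mul_le_mul_of_nonneg_left (norm_markovOperator_pow_le_sqrt_pow p ν hν k hf m) (norm_nonneg _)
    _ = _ := by ring

theorem memLp_eval_chainLaw (p : Kernel S S) [IsMarkovKernel p] {ν : Measure S}
    [IsProbabilityMeasure ν] (hν : p.Invariant ν) {g : S → ℝ} (hg : MemLp g 2 ν) (n : ℕ) :
    MemLp (fun θ : ℕ → S => g (θ n)) 2 (chainLaw p ν) :=
  hg.comp_measurePreserving (measurePreserving_eval_chainLaw p hν n)

/-- The gap stands as a factor on the left so that the estimate can be proved for each `k`
separately and passed to the supremum, with no need for positivity of the gap or a maximizing `k`.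
-/
theorem pseudoSpectralGap_mul_integral_sq_sum_le (p : Kernel S S) [IsMarkovKernel p]
    (ν : Measure S) [IsProbabilityMeasure ν] (hν : p.Invariant ν) {f : Lp ℝ 2 ν}
    (hf : f ∈ meanZero ν) (N nb : ℕ) :
    pseudoSpectralGap p ν hν *
        ∫ θ, (∑ n ∈ Finset.Icc 1 N, f (θ (n + nb))) ^ 2 ∂(chainLaw p ν)
      ≤ 4 * N * ‖f‖ ^ 2 := by
  set P := markovOperator p ν hν with hP
  set B := ∫ θ, (∑ n ∈ Finset.Icc 1 N, f (θ (n + nb))) ^ 2 ∂(chainLaw p ν) with hB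
  have hB0 : 0 ≤ B := integral_nonneg fun _ => sq_nonneg _
  have hpair : ∀ a b : ℕ, ∫ θ, f (θ a) * f (θ b) ∂(chainLaw p ν)
      = inner ℝ f ((P ^ Nat.dist a b) f) := by
    have hle : ∀ a b : ℕ, a ≤ b → ∫ θ, f (θ a) * f (θ b) ∂(chainLaw p ν)
        = inner ℝ f ((P ^ Nat.dist a b) f) := fun a b hab => by
      obtain ⟨m, rfl⟩ := Nat.exists_eq_add_of_le hab
      rw [integral_chainLaw_mul p hν, Nat.dist_eq_sub_of_le hab, Nat.add_sub_cancel_left]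
    intro a b
    rcases le_total a b with hab | hab
    · exact hle a b hab
    · rw [Nat.dist_comm, ← hle b a hab]
      simp only [mul_comm]
  have hint : ∀ a b : ℕ, Integrable (fun θ : ℕ → S => f (θ a) * f (θ b)) (chainLaw p ν) :=
    fun a b => (memLp_eval_chainLaw p hν (Lp.memLp f) a).integrable_mul
      (memLp_eval_chainLaw p hν (Lp.memLp f) b)
  have hexp : B = ∑ i ∈ Finset.Icc 1 N, ∑ j ∈ Finset.Icc 1 N,
      inner ℝ f ((P ^ Nat.dist i j) f) := by
    simp only [hB, sq, Finset.sum_mul_sum]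
    rw [integral_finsetSum _ fun i _ => integrable_finsetSum _ fun j _ => hint _ _]
    refine Finset.sum_congr rfl fun i _ => ?_
    rw [integral_finsetSum _ fun j _ => hint _ _]
    refine Finset.sum_congr rfl fun j _ => ?_
    rw [hpair, Nat.dist_add_add_right]
  have key : ∀ k : ℕ+, spectralGap (ContinuousLinearMap.adjoint P ^ (k : ℕ) * P ^ (k : ℕ)) / (k : ℝ)
      * B ≤ 4 * N * ‖f‖ ^ 2 := by
    intro k
    set γ := spectralGap (ContinuousLinearMap.adjoint P ^ (k : ℕ) * P ^ (k : ℕ)) with hγ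
    have hk : (0 : ℝ) < k := by exact_mod_cast k.pos
    -- For `γ ≤ 0` the left side is not positive. Otherwise `1 - γ ≤ 1`, as the geometric estimate
    -- requires.
    rcases le_total γ 0 with h0 | h0
    · exact (mul_nonpos_of_nonpos_of_nonneg (div_nonpos_of_nonpos_of_nonneg h0 hk.le) hB0).trans
        (by positivity)
    · have hγ1 : 0 ≤ 1 - γ := by simp only [hγ, spectralGap, sub_sub_cancel]; positivity
      have hb : B ≤ ∑ i ∈ Finset.Icc 1 N,
          2 * (∑ m ∈ Finset.range N, √(1 - γ) ^ (m / (k : ℕ))) * ‖f‖ ^ 2 := by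
        rw [hexp]
        refine Finset.sum_le_sum fun i hi => ?_
        refine (Finset.sum_le_sum fun j _ =>
          inner_markovOperator_pow_le p ν hν k hf (Nat.dist i j)).trans ?_
        rw [← Finset.sum_mul]
        exact mul_le_mul_of_nonneg_right (sum_Icc_comp_dist_le
          (c := fun m => √(1 - γ) ^ (m / (k : ℕ))) (fun _ => by positivity) hi) (sq_nonneg _)
      rw [Finset.sum_const, Nat.card_Icc, Nat.add_sub_cancel, nsmul_eq_mul] at hb
      have h2 := mul_sum_sqrt_pow_div_le_two k.pos hγ1 (by linarith) N
      rw [sub_sub_cancel] at h2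
      calc γ / k * B ≤ γ / k * _ := mul_le_mul_of_nonneg_left hb (div_nonneg h0 hk.le)
        _ = (γ / k * ∑ m ∈ Finset.range N, √(1 - γ) ^ (m / (k : ℕ))) * (2 * N * ‖f‖ ^ 2) := by ring
        _ ≤ 2 * (2 * N * ‖f‖ ^ 2) := mul_le_mul_of_nonneg_right h2 (by positivity)
        _ = _ := by ring
  rcases hB0.eq_or_lt with h0 | h0
  · rw [← h0, mul_zero]; positivity
  · rw [← le_div_iff₀ h0]
    exact ciSup_le fun k => (le_div_iff₀ h0).2 (key k)

/-! ### Mean square error -/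

theorem squaredError_eq {ν : Measure S} (Y : S → ℝ) {N : ℕ} (hN : 1 ≤ N) (nb : ℕ) (θ : ℕ → S) :
    squaredError ν Y N nb θ =
      (∑ n ∈ Finset.Icc 1 N, (Y (θ (n + nb)) - ∫ x, Y x ∂ν)) ^ 2 / (N : ℝ) ^ 2 := by
  have hN' : (N : ℝ) ≠ 0 := by positivity
  rw [squaredError, ergodicEstimator, Finset.sum_sub_distrib, Finset.sum_const, Nat.card_Icc,
    Nat.add_sub_cancel, nsmul_eq_mul]
  field_simp

theorem integrable_squaredError_chainLaw (p : Kernel S S) [IsMarkovKernel p] (ν : Measure S)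
    [IsProbabilityMeasure ν] (hν : p.Invariant ν) {Y : S → ℝ} (hY : MemLp Y 2 ν) (N nb : ℕ) :
    Integrable (squaredError ν Y N nb) (chainLaw p ν) := by
  have h : MemLp (fun θ => ergodicEstimator Y N nb θ - ∫ x, Y x ∂ν) 2 (chainLaw p ν) :=
    ((memLp_finsetSum _ fun n _ => memLp_eval_chainLaw p hν hY (n + nb)).const_mul _).sub
      (memLp_const _)
  exact h.integrable_sq

theorem meanSquareError_stationary_le (p : Kernel S S) [IsMarkovKernel p] (ν : Measure S)
    [IsProbabilityMeasure ν] (hν : p.Invariant ν) (hgap : 0 < pseudoSpectralGap p ν hν)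
    {Y : S → ℝ} (hY : MemLp Y 2 ν) {N : ℕ} (hN : 1 ≤ N) (nb : ℕ) :
    meanSquareError p ν ν Y N nb ≤ 4 / pseudoSpectralGap p ν hν * (variance Y ν / N) := by
  have hg : MemLp (fun x => Y x - ∫ x, Y x ∂ν) 2 ν := hY.sub (memLp_const _)
  set f : Lp ℝ 2 ν := hg.toLp with hfdef
  have hfae : f =ᵐ[ν] fun x => Y x - ∫ x, Y x ∂ν := hg.coeFn_toLp
  have hYi : Integrable Y ν := hY.integrable (by norm_num)
  have hf0 : f ∈ meanZero ν := by
    rw [mem_meanZero_iff, integral_congr_ae hfae, integral_sub hYi (integrable_const _)]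
    simp
  have hfn : ‖f‖ ^ 2 = variance Y ν := by
    rw [norm_sq_eq_integral_sq, variance_eq_integral hY.1.aemeasurable]
    refine integral_congr_ae ?_
    filter_upwards [hfae] with x hx
    rw [hx]
  have hmse : meanSquareError p ν ν Y N nb =
      (∫ θ, (∑ n ∈ Finset.Icc 1 N, f (θ (n + nb))) ^ 2 ∂(chainLaw p ν)) / (N : ℝ) ^ 2 := by
    rw [meanSquareError, ← integral_div]
    -- Every `θ n` has law `ν`, so along almost every trajectory the `L²` class `f` may be evaluated
    -- as `Y` minus its mean at all times simultaneously.
    have hall : ∀ᵐ θ ∂(chainLaw p ν), ∀ n : ℕ, f (θ n) = Y (θ n) - ∫ x, Y x ∂ν :=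
      ae_all_iff.2 fun n =>
        (measurePreserving_eval_chainLaw p hν n).quasiMeasurePreserving.ae hfae
    refine integral_congr_ae ?_
    filter_upwards [hall] with θ hθ
    simp only [squaredError_eq Y hN, hθ]
  have hmain := pseudoSpectralGap_mul_integral_sq_sum_le p ν hν hf0 N nb
  have hN' : (0 : ℝ) < N := by exact_mod_cast hN
  rw [hmse, ← hfn, div_mul_div_comm, div_le_div_iff₀ (by positivity) (by positivity)]
  nlinarith [mul_le_mul_of_nonneg_left hmain hN'.le]

/-! ### Change of the initial law -/

theorem initialDiscrepancy_nonneg (ν₀ ν : Measure S) : 0 ≤ initialDiscrepancy ν₀ ν :=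
  ENNReal.toReal_nonneg

theorem le_smul_of_initialDiscrepancy {ν₀ ν : Measure S} [IsProbabilityMeasure ν]
    [IsProbabilityMeasure ν₀] (hac : ν₀ ≪ ν) (hbdd : MemLp (initialDensity ν₀ ν) ∞ ν) :
    ν₀ ≤ ENNReal.ofReal (1 + initialDiscrepancy ν₀ ν) • ν := by
  have hmem : MemLp (fun x => initialDensity ν₀ ν x - 1) ∞ ν := hbdd.sub (memLp_const 1)
  have hae : ∀ᵐ x ∂ν, ν₀.rnDeriv ν x ≤ ENNReal.ofReal (1 + initialDiscrepancy ν₀ ν) := by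
    filter_upwards [ae_le_eLpNormEssSup (f := fun x => initialDensity ν₀ ν x - 1) (μ := ν),
      ν₀.rnDeriv_lt_top ν] with x hx hlt
    rw [← eLpNorm_exponent_top] at hx
    have h1 : |initialDensity ν₀ ν x - 1| ≤ initialDiscrepancy ν₀ ν := by
      have h := ENNReal.toReal_mono hmem.eLpNorm_ne_top hx
      rwa [toReal_enorm, Real.norm_eq_abs] at h
    rw [← ENNReal.ofReal_toReal hlt.ne]
    refine ENNReal.ofReal_le_ofReal ?_
    have := (abs_le.1 h1).2
    rw [initialDensity] at this
    linarith
  calc ν₀ = ν.withDensity (ν₀.rnDeriv ν) := (Measure.withDensity_rnDeriv_eq _ _ hac).symm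
    _ ≤ ν.withDensity fun _ => ENNReal.ofReal (1 + initialDiscrepancy ν₀ ν) :=
      withDensity_mono hae
    _ = _ := withDensity_const _

/-- The trajectory law is the initial law integrated against a fixed kernel, hence monotone and
homogeneous in the initial law. -/
theorem chainLaw_le_smul (p : Kernel S S) [IsMarkovKernel p] {ν₀ ν : Measure S} {c : ℝ≥0∞}
    (h : ν₀ ≤ c • ν) : chainLaw p ν₀ ≤ c • chainLaw p ν := by
  refine Measure.le_iff.2 fun A hA => ?_
  rw [Measure.smul_apply, chainLaw, chainLaw, Kernel.trajMeasure, Kernel.trajMeasure,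
    Measure.bind_apply hA (Kernel.aemeasurable _), Measure.bind_apply hA (Kernel.aemeasurable _),
    ← lintegral_smul_measure, ← Measure.map_smul]
  exact lintegral_mono' (Measure.map_mono h (by fun_prop)) le_rfl

theorem integrable_squaredError_and_meanSquareError_le (p : Kernel S S) [IsMarkovKernel p]
    (ν : Measure S) [IsProbabilityMeasure ν] (hν : p.Invariant ν)
    (hgap : 0 < pseudoSpectralGap p ν hν) (ν₀ : Measure S) [IsProbabilityMeasure ν₀]
    (hac : ν₀ ≪ ν) (hbdd : MemLp (initialDensity ν₀ ν) ∞ ν) {Y : S → ℝ} (hY : MemLp Y 2 ν)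
    {N : ℕ} (hN : 1 ≤ N) (nb : ℕ) :
    Integrable (squaredError ν Y N nb) (chainLaw p ν₀) ∧
      meanSquareError p ν₀ ν Y N nb ≤ constMse p ν₀ ν hν * (variance Y ν / N) := by
  have hle := chainLaw_le_smul p (le_smul_of_initialDiscrepancy hac hbdd)
  have hD := initialDiscrepancy_nonneg ν₀ ν
  set D := initialDiscrepancy ν₀ ν with hDdef
  have hi := (integrable_squaredError_chainLaw p ν hν hY N nb).smul_measure
    (ENNReal.ofReal_ne_top (r := 1 + D))
  refine ⟨hi.mono_measure hle, ?_⟩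
  have h1 : meanSquareError p ν₀ ν Y N nb ≤ (1 + D) * meanSquareError p ν ν Y N nb := by
    have h := integral_mono_measure hle (ae_of_all _ fun θ => sq_nonneg _) hi
    rwa [integral_smul_measure, ENNReal.toReal_ofReal (by linarith)] at h
  have h2 := meanSquareError_stationary_le p ν hν hgap hY hN nb
  have hV : 0 ≤ variance Y ν / N := div_nonneg (variance_nonneg _ _) (Nat.cast_nonneg _)
  have hg4 : 0 ≤ 4 / pseudoSpectralGap p ν hν := by positivity
  rw [constMse, constInv, constNs, ← hDdef]
  set G := 4 / pseudoSpectralGap p ν hν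
  calc meanSquareError p ν₀ ν Y N nb ≤ (1 + D) * (G * (variance Y ν / N)) :=
        h1.trans (mul_le_mul_of_nonneg_left h2 (by linarith))
    _ = ((1 + D) * G) * (variance Y ν / N) := by ring
    -- The stated constant `(1 + 2D)(1 + G)` exceeds `(1 + D)G` by `1 + 2D + DG ≥ 0`.
    _ ≤ _ := mul_le_mul_of_nonneg_right (by nlinarith [mul_nonneg hD hg4]) hV

end Chain

/-! ### Minorization of the coupled chain -/

/-- A minimum over the compact sublevel set through any point `z₀` is a global minimum, and it is
positive because the ratio is. -/
theorem exists_pos_le_div_of_isCompact {X : Type*} [TopologicalSpace X] {Q π : X → ℝ}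
    (hQ : Continuous Q) (hπ : Continuous π) (hQ0 : ∀ z, 0 < Q z) (hπ0 : ∀ z, 0 < π z)
    (hc : ∀ r : ℝ, 0 < r → IsCompact {θ | Q θ / π θ ≤ r}) :
    ∃ c : ℝ, 0 < c ∧ ∀ θ, c ≤ Q θ / π θ := by
  rcases isEmpty_or_nonempty X with hX | ⟨⟨z₀⟩⟩
  · exact ⟨1, one_pos, fun θ => hX.elim θ⟩
  · have hcont : Continuous fun θ => Q θ / π θ := hQ.div hπ fun z => (hπ0 z).ne'
    obtain ⟨z, hz, hmin⟩ := (hc _ (div_pos (hQ0 z₀) (hπ0 z₀))).exists_isMinOn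
      ⟨z₀, le_refl (Q z₀ / π z₀)⟩ hcont.continuousOn
    refine ⟨_, div_pos (hQ0 z) (hπ0 z), fun θ => ?_⟩
    by_cases hθ : Q θ / π θ ≤ Q z₀ / π z₀
    · exact hmin hθ
    · exact le_trans hz (not_le.1 hθ).le

/-- The right side is the minimum of `Q z` and `(Q θ / π θ) π z`. The lower bound on the ratio, used
at `z` and at `θ` respectively, bounds both by `c π z`, which is free of `θ`. -/
theorem mul_le_acceptProb_mul {X : Type*} {π Q : X → ℝ} (hQ0 : ∀ z, 0 < Q z)
    (hπ0 : ∀ z, 0 < π z) {c : ℝ} (hc : ∀ θ, c ≤ Q θ / π θ) (θ z : X) :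
    c * π z ≤ acceptProb π Q θ z * Q z := by
  rw [acceptProb, min_mul_of_nonneg _ _ (hQ0 z).le, one_mul]
  refine le_min ?_ ?_
  · exact (le_div_iff₀ (hπ0 z)).1 (hc z)
  · have h := mul_le_mul_of_nonneg_right (hc θ) (hπ0 z).le
    refine h.trans_eq ?_
    have := (hQ0 z).ne'
    have := (hπ0 θ).ne'
    field_simp

namespace MultilevelModel

variable {X : Type*} [MeasurableSpace X] (M : MultilevelModel X)

theorem exists_minorizing_measure [TopologicalSpace X] (hM : M.Assumptions) (i : Fin M.L) :
    ∃ m : Measure (X × X), 0 < m.real univ ∧ ∀ θ, m ≤ M.jointKernel i θ := by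
  obtain ⟨c₁, hc₁, h₁⟩ := exists_pos_le_div_of_isCompact (hM.prop_continuous i)
    (hM.post_continuous i.castSucc) (hM.prop_pos i) (hM.post_pos _) (hM.compact_coarse i)
  obtain ⟨c₂, hc₂, h₂⟩ := exists_pos_le_div_of_isCompact (hM.prop_continuous i)
    (hM.post_continuous i.succ) (hM.prop_pos i) (hM.post_pos _) (hM.compact_fine i)
  -- The density of simultaneous moves to `z` is the minimum of the two accepted proposal densities,
  -- so the minimum of their `θ`-free lower bounds minorizes it.
  set d : X → ℝ≥0∞ := fun z =>
    ENNReal.ofReal (min (c₁ * M.post i.castSucc z) (c₂ * M.post i.succ z)) with hd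
  have hdm : Measurable d := (((M.post_measurable _).const_mul _).min
    ((M.post_measurable _).const_mul _)).ennreal_ofReal
  have hdiag : Measurable fun z : X => (z, z) := by fun_prop
  set m := (M.prior.withDensity d).map fun z => (z, z) with hm
  have hle : ∀ θ, m ≤ M.jointKernel i θ := fun θ => by
    have h : m ≤ (M.prior.withDensity fun z => ENNReal.ofReal
        (min (M.acceptCoarse i θ z) (M.acceptFine i θ z) * M.prop i z)).map (fun z => (z, z)) := by
      refine Measure.map_mono (withDensity_mono (ae_of_all _ fun z => ?_)) hdiag
      refine ENNReal.ofReal_le_ofReal ?_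
      rw [min_mul_of_nonneg _ _ (hM.prop_pos i z).le]
      exact min_le_min (mul_le_acceptProb_mul (hM.prop_pos i) (hM.post_pos _) h₁ _ _)
        (mul_le_acceptProb_mul (hM.prop_pos i) (hM.post_pos _) h₂ _ _)
    refine h.trans ?_
    simp only [jointKernel, Kernel.coe_mk, add_assoc]
    exact Measure.le_add_right le_rfl
  refine ⟨m, ?_, hle⟩
  obtain ⟨z₀⟩ : Nonempty X := nonempty_of_isProbabilityMeasure M.prior
  have hfin : m univ ≠ ∞ :=
    ((hle (z₀, z₀) univ).trans_lt (measure_lt_top _ _)).ne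
  refine ENNReal.toReal_pos ?_ hfin
  rw [hm, Measure.map_apply hdiag .univ, preimage_univ, withDensity_apply _ .univ,
    Measure.restrict_univ]
  -- The minorizing density is strictly positive everywhere and the prior has mass one, so the mass
  -- of `m` is not zero.
  refine (lintegral_pos_iff_support hdm).2 ?_ |>.ne'
  have : Function.support d = univ := by
    refine eq_univ_of_forall fun z => ?_
    simp only [Function.mem_support, hd, ne_eq, ENNReal.ofReal_eq_zero, not_le]
    exact lt_min (mul_pos hc₁ (hM.post_pos _ z)) (mul_pos hc₂ (hM.post_pos _ z))
  rw [this, measure_univ]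
  exact one_pos

end MultilevelModel

theorem mainTheorem2 {X : Type*} [TopologicalSpace X] [PolishSpace X] [MeasurableSpace X]
    [BorelSpace X] (M : MultilevelModel X) (hM : M.Assumptions) (i : Fin M.L)
    (ν : Measure (X × X)) [IsProbabilityMeasure ν] (hν : (M.jointKernel i).Invariant ν)
    (ν₀ : Measure (X × X)) [IsProbabilityMeasure ν₀] (hac : ν₀ ≪ ν)
    (hbdd : MemLp (initialDensity ν₀ ν) ∞ ν)
    (Y : X × X → ℝ) (hY : MemLp Y 2 ν) (N nb : ℕ) (hN : 1 ≤ N) :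
    0 < pseudoSpectralGap (M.jointKernel i) ν hν ∧
    Integrable (squaredError ν Y N nb) (chainLaw (M.jointKernel i) ν₀) ∧
    meanSquareError (M.jointKernel i) ν₀ ν Y N nb
      ≤ constMse (M.jointKernel i) ν₀ ν hν * (variance Y ν / N) := by
  obtain ⟨m, hm0, hm⟩ := M.exists_minorizing_measure hM i
  have hgap : 0 < pseudoSpectralGap (M.jointKernel i) ν hν :=
    hm0.trans_le (measureReal_le_pseudoSpectralGap_of_minorized _ ν hν hm)
  exact ⟨hgap, integrable_squaredError_and_meanSquareError_le _ ν hν hgap ν₀ hac hbdd hY hN nb⟩
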